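/- Let $d\in\mathbb N$, $0<\alpha<2$, $1\le p<\infty$, and let $(\Omega,\Sigma,P)$ be a probability space. A symmetric $\alpha$-stable random measure on $[0,1]^d$ with Lebesgue control measure is a family of real random variables $M(A)$, $A\subset[0,1]^d$ Borel, such that (a) $\mathbb E\,e^{itM(A)}=\exp(-|A|\,|t|^\alpha)$ for all $t\in\mathbb R$, where $|A|$ is the Lebesgue measure of $A$; (b) $M(A_1),\dots,M(A_k)$ are independent if $A_1,\dots,A_k$ are disjoint; (c) $M(\bigcup_{j}A_j)=\sum_{j=1}^\infty M(A_j)$ almost surely if $A_1,A_2,\dots$ are disjoint. Let $U=(U(x))_{x\in[0,1]^d}$ be a symmetric $\alpha$-stable sheet, i.e. a random field on $\Omega$ for which there is such an $M$ with $$U(x)=\int_{[0,1]^d} 1_{\{x'\le x\}}\,M(dx')=M(\{x'\in[0,1]^d: x'_i\le x_i,\ i=1,\dots,d\})\quad\text{a.s., for every } x\in[0,1]^d .$$ Then $U$ has a version that is jointly measurable in $(x,\omega)$. Fix any such version and denote it again by $U$. For $N\ge 1$ and $h=1/N$ put $$U^N(x)=U(h\lceil x/h\rceil),\qquad x\in[0,1]^d,$$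 with the ceiling taken in each coordinate. Then $U$ and all $U^N$ have almost surely paths in $F=L^p([0,1]^d)$ and define $F$-valued random variables; let $\mu$ and $\mu_N$ be their distributions on $F$. Let $G$ be a real normed space (the data space) and let $\Phi:F\times G\to[0,\infty)$ be a function (the negative log-likelihood) such that * $\Phi$ is bounded on bounded subsets of $F\times G$ (WD2); * $u\mapsto\Phi(u,y)$ is continuous on $F$ for every $y\in G$ (PC1). Then for every $y\in G$ the normalizing constants $Z_y=\int_F e^{-\Phi(u,y)}\mu(du)$ and $Z_y^N=\int_F e^{-\Phi(u,y)}\mu_N(du)$, $N\ge1$, are positive and finite, and the posterior distributions $$\mu_N^y(du)=\frac{1}{Z_y^N}e^{-\Phi(u,y)}\mu_N(du)$$ converge weakly on $F$, as $N\to\infty$, to the posterior distribution $$\mu^y(du)=\frac1{Z_y}e^{-\Phi(u,y)}\mu(du).$$ -/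

import Mathlib

open MeasureTheory ProbabilityTheory Filter Topology
open scoped ENNReal

noncomputable section

/-- The unit cube `[0,1]^d`, with the componentwise order and with its Borel sets; its `volume` is
the `d`-dimensional Lebesgue measure. -/
abbrev Cube (d : ℕ) : Type := Fin d → unitInterval

/-- The space `L^p([0,1]^d)` of real functions. -/
abbrev LpCube (d : ℕ) (p : ℝ≥0∞) : Type := Lp ℝ p (volume : Measure (Cube d))

instance instMeasurableSpaceLpCube (d : ℕ) (p : ℝ≥0∞) [Fact (1 ≤ p)] :
    MeasurableSpace (LpCube d p) := borel _

instance instBorelSpaceLpCube (d : ℕ) (p : ℝ≥0∞) [Fact (1 ≤ p)] : BorelSpace (LpCube d p) := ⟨rfl⟩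

/-- The real random variable `X` has the symmetric stable distribution `S_α(σ, 0, 0)`: its
characteristic function is `t ↦ exp (-σ^α |t|^α)`. -/
def HasSymmetricStableLaw {Ω : Type*} [MeasurableSpace Ω] (α σ : ℝ) (P : Measure Ω) (X : Ω → ℝ) :
    Prop :=
  ∀ t : ℝ, charFun (P.map X) t = Complex.exp (-((σ ^ α * |t| ^ α : ℝ) : ℂ))

/-- `M` is a symmetric `α`-stable random measure on `E` with control measure `m`: a random set
function on the measurable sets of finite `m`-measure which is independently scattered, almost
surely σ-additive, and such that `M A` has the law `S_α(m(A)^{1/α}, 0, 0)`.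
The series in `tendsto_sum` is an ordinary series: for `1 ≤ α` it need not converge absolutely. -/
structure IsSymmetricStableRandomMeasure {Ω E : Type*} [MeasurableSpace Ω] [MeasurableSpace E]
    (α : ℝ) (m : Measure E) (P : Measure Ω) (M : Set E → Ω → ℝ) : Prop where
  measurable : ∀ A, MeasurableSet A → m A < ∞ → Measurable (M A)
  stable : ∀ A, MeasurableSet A → m A < ∞ →
    HasSymmetricStableLaw α ((m A).toReal ^ (1 / α)) P (M A)
  indep : ∀ (k : ℕ) (A : Fin k → Set E), (∀ i, MeasurableSet (A i)) → (∀ i, m (A i) < ∞) →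
    Pairwise (Function.onFun Disjoint A) → iIndepFun (fun i => M (A i)) P
  tendsto_sum : ∀ A : ℕ → Set E, (∀ j, MeasurableSet (A j)) → Pairwise (Function.onFun Disjoint A) →
    m (⋃ j, A j) < ∞ →
    ∀ᵐ ω ∂P, Tendsto (fun n => ∑ j ∈ Finset.range n, M (A j) ω) atTop (𝓝 (M (⋃ j, A j) ω))

/-- The random field `U` on `[0,1]^d` is a symmetric `α`-stable sheet: up to a version it is
`U(x) = ∫ f(x,x') M(dx')`, where `M` is a symmetric `α`-stable random measure with Lebesgue control
measure and `f(x,·)` is the indicator function of `{x' | x' ≤ x}`. The stochastic integral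
of the indicator function of a set is the value of `M` on this set. -/
def IsStableSheet {Ω : Type*} [MeasurableSpace Ω] (d : ℕ) (α : ℝ) (P : Measure Ω)
    (U : Cube d → Ω → ℝ) : Prop :=
  ∃ M : Set (Cube d) → Ω → ℝ,
    IsSymmetricStableRandomMeasure α (volume : Measure (Cube d)) P M ∧
      ∀ x : Cube d, U x =ᵐ[P] M {x' | ∀ i, x' i ≤ x i}

/-- `V` is a version of the random field `U` that is jointly measurable in `(x, ω)`. -/
def IsMeasurableVersion {Ω : Type*} [MeasurableSpace Ω] {d : ℕ} (P : Measure Ω)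
    (U V : Cube d → Ω → ℝ) : Prop :=
  Measurable (fun z : Cube d × Ω => V z.1 z.2) ∧ ∀ x : Cube d, V x =ᵐ[P] U x

/-- The grid point `h ⌈x / h⌉` of the cube, where `h = 1 / N`. -/
def gridPoint {d : ℕ} (N : ℕ+) (x : Cube d) : Cube d := fun i =>
  ⟨(1 / (N : ℝ)) * (⌈(x i : ℝ) / (1 / (N : ℝ))⌉ : ℝ), by
    have hN : (0 : ℝ) < (N : ℝ) := by exact_mod_cast N.pos
    have h0 : (0 : ℝ) ≤ (x i : ℝ) := (x i).2.1
    have h1 : (x i : ℝ) ≤ 1 := (x i).2.2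
    have e : (x i : ℝ) / (1 / (N : ℝ)) = x i * N := by field_simp
    rw [e]
    constructor
    · have : (0 : ℝ) ≤ (⌈(x i : ℝ) * N⌉ : ℝ) := by
        exact_mod_cast Int.ceil_nonneg (by positivity)
      positivity
    · have h2 : ⌈(x i : ℝ) * N⌉ ≤ ((N : ℕ) : ℤ) := by
        rw [Int.ceil_le]
        push_cast
        nlinarith
      have h3 : (⌈(x i : ℝ) * N⌉ : ℝ) ≤ N := by exact_mod_cast h2
      rw [one_div, inv_mul_le_iff₀ hN]
      linarith⟩

/-- The grid discretization `U^N(x) = U(h ⌈x / h⌉)`, `h = 1 / N`. -/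
def discretization {Ω : Type*} {d : ℕ} (U : Cube d → Ω → ℝ) (N : ℕ+) : Cube d → Ω → ℝ :=
  fun x ω => U (gridPoint N x) ω

open scoped Classical in
/-- The path `x ↦ U(x, ω)` as an element of `L^p([0,1]^d)` (and `0` if it is not in `L^p`). -/
def lpPath {Ω : Type*} {d : ℕ} (p : ℝ≥0∞) (U : Cube d → Ω → ℝ) (ω : Ω) : LpCube d p :=
  if h : MemLp (fun x => U x ω) p (volume : Measure (Cube d)) then h.toLp _ else 0

/-- The random field `U` is, through its paths, a random variable with values in `L^p([0,1]^d)`. -/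
def IsLpValued {Ω : Type*} [MeasurableSpace Ω] {d : ℕ} (p : ℝ≥0∞) [Fact (1 ≤ p)] (P : Measure Ω)
    (U : Cube d → Ω → ℝ) : Prop :=
  (∀ᵐ ω ∂P, MemLp (fun x => U x ω) p (volume : Measure (Cube d))) ∧ AEMeasurable (lpPath p U) P

/-- The distribution of the random field `U` on `L^p([0,1]^d)`. -/
def lpLaw {Ω : Type*} [MeasurableSpace Ω] {d : ℕ} (p : ℝ≥0∞) [Fact (1 ≤ p)] (P : Measure Ω)
    (U : Cube d → Ω → ℝ) : Measure (LpCube d p) :=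
  P.map (lpPath p U)

/-- `Φ` is bounded on bounded subsets of `F × G`. -/
def BoundedOnBounded {F G : Type*} [NormedAddCommGroup F] [NormedAddCommGroup G]
    (Φ : F × G → ℝ) : Prop :=
  ∀ B : Set (F × G), Bornology.IsBounded B → Bornology.IsBounded (Φ '' B)

/-- The normalizing constant `Z_y = ∫ exp (-Φ(u,y)) μ(du)`, as an extended non-negative number. -/
def normalizer {F G : Type*} [MeasurableSpace F] (Φ : F × G → ℝ) (μ : Measure F) (y : G) : ℝ≥0∞ :=
  ∫⁻ u, ENNReal.ofReal (Real.exp (-Φ (u, y))) ∂μ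

/-- The posterior distribution `μ^y(du) = Z_y⁻¹ exp (-Φ(u,y)) μ(du)`. -/
def posteriorMeasure {F G : Type*} [MeasurableSpace F] (Φ : F × G → ℝ) (μ : Measure F) (y : G) :
    Measure F :=
  μ.tilted (fun u => -Φ (u, y))

end

/-!
The discretizations `U^N` converge in distribution on `L^p` to the sheet `U`, and the density
`exp (-Φ(·, y))` is continuous, positive and bounded by `1`. So for a bounded continuous `f` the
integrals of `f exp (-Φ(·, y))` and of `exp (-Φ(·, y))` against `μ_N` converge to those against `μ`,
and their quotients are the integrals of `f` against the posterior distributions.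

Moments are of no use for the convergence in `L^p`, because `U(x)`, unless it
vanishes, has no absolute moment of order `p ≥ α`. Two properties of the random measure `M` replace them.

* The sheet is almost surely bounded on the union of all grids
  (`IsSymmetricStableRandomMeasure.ae_exists_forall_gridPoint_le`). On one grid its values are the
  sums over lower boxes of an array of independent symmetric variables, and Lévy's maximal
  inequality, applied to one coordinate after the other
  (`SignInvariant.measure_compl_boundedPartialSums_le`), gives
  `P (max |U| > r) ≤ 2 ^ d * P (|M([0,1]^d)| > r)`, with a bound that does not depend on the grid.
* The sheet is continuous in probability from the upper right
  (`IsSymmetricStableRandomMeasure.tendstoInMeasure`), because `M A` has the law of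
  `|A|^{1/α} M([0,1]^d)`. Hence `U^N → U` in measure on `[0,1]^d × Ω`, and along subsequences almost
  everywhere.

Together they allow dominated convergence path by path
(`exists_ae_tendsto_lpPath_discretization`): every sequence of discretizations has a subsequence that
converges in `L^p` almost surely. This gives the measurability of `ω ↦ U(·, ω)` as well as the
convergence in distribution. The jointly measurable version exists because, along the dyadic grids,
the boxes below the rounded points decrease to the box below `x`, where `M` is almost surely
continuous from above.
-/

/-! ### Lévy's maximal inequality for arrays -/

/-- The measure `ν` on `ℝ^ι` is invariant under changing the signs of any set of coordinates. -/
def SignInvariant {ι : Type*} (ν : Measure (ι → ℝ)) : Prop :=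
  ∀ s : Set ι, MeasurePreserving (fun x i => s.indicator x i - sᶜ.indicator x i) ν ν

/-- The joint law of independent symmetric random variables is invariant under changes of sign. -/
theorem signInvariant_map_of_iIndepFun {ι Ω : Type*} [Fintype ι] [MeasurableSpace Ω]
    {P : Measure Ω} [IsProbabilityMeasure P] {X : ι → Ω → ℝ} (hX : ∀ i, Measurable (X i))
    (hind : iIndepFun X P) (hsymm : ∀ i, (P.map (X i)).map (fun x => -x) = P.map (X i)) :
    SignInvariant (P.map (fun ω i => X i ω)) := by
  classical
  intro s
  rw [(iIndepFun_iff_map_fun_eq_pi_map fun i => (hX i).aemeasurable).1 hind]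
  have hprob : ∀ i, IsProbabilityMeasure (P.map (X i)) := fun i =>
    Measure.isProbabilityMeasure_map (hX i).aemeasurable
  have key : ∀ i, MeasurePreserving (fun x : ℝ => if i ∈ s then x else -x)
      (P.map (X i)) (P.map (X i)) := by
    intro i
    by_cases hi : i ∈ s
    · simp only [hi, if_true]
      exact MeasurePreserving.id _
    · simp only [hi, if_false]
      exact ⟨measurable_neg, hsymm i⟩
  convert measurePreserving_pi _ _ key using 3 with x i
  by_cases hi : i ∈ s <;> simp [hi]

theorem measurable_set_indicator {ι : Type*} (s : Set ι) :
    Measurable fun x : ι → ℝ => s.indicator x := by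
  refine measurable_pi_lambda _ fun i => ?_
  by_cases hi : i ∈ s
  · simpa [hi] using measurable_pi_apply i
  · simp [hi]

/-- Lévy's inequality: if the partial sums `1_{A k} x` along an increasing family of coordinate
sets leave the convex set `C`, then with conditional probability at least one half the full vector
lies outside `C`. If `k` is the first exit index, reflecting the coordinates outside `A k` preserves
both the law and the event of a first exit at `k`, and `1_{A k} x` is the midpoint of `x` and its
reflection, so that not both of them lie in `C`. -/
theorem SignInvariant.measure_exists_indicator_notMem_le {ι κ : Type*} [Fintype ι] [Fintype κ]
    [LinearOrder κ] {ν : Measure (ι → ℝ)} (hν : SignInvariant ν) {A : κ → Set ι} (hA : Monotone A)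
    {C : Set (ι → ℝ)} (hCm : MeasurableSet C) (hC : Convex ℝ C) :
    ν {x | ∃ k, (A k).indicator x ∉ C} ≤ 2 * ν Cᶜ := by
  classical
  have hind : ∀ s : Set ι, Measurable fun x : ι → ℝ => s.indicator x := measurable_set_indicator
  -- `T k` is the event that the first exit occurs at `k`
  set T : κ → Set (ι → ℝ) := fun k =>
    {x | (A k).indicator x ∉ C ∧ ∀ j < k, (A j).indicator x ∈ C} with hT
  have hTm : ∀ k, MeasurableSet (T k) := by
    intro k
    have : T k = ((fun x : ι → ℝ => (A k).indicator x) ⁻¹' C)ᶜ ∩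
        ⋂ j, ⋂ (_ : j < k), ((fun x : ι → ℝ => (A j).indicator x) ⁻¹' C) := by
      ext x; simp [hT]
    rw [this]
    exact ((hind _) hCm).compl.inter
      (MeasurableSet.iInter fun j => MeasurableSet.iInter fun _ => (hind _) hCm)
  have hTd : Pairwise (Function.onFun Disjoint T) := by
    intro k l hkl
    refine Set.disjoint_left.2 fun x hk hl => ?_
    rcases lt_or_gt_of_ne hkl with h | h
    · exact hk.1 (hl.2 k h)
    · exact hl.1 (hk.2 l h)
  have hcover : {x | ∃ k, (A k).indicator x ∉ C} ⊆ ⋃ k, T k := by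
    rintro x ⟨k, hk⟩
    obtain ⟨m, hm, hmin⟩ := WellFounded.has_min (wellFounded_lt (α := κ))
      {k | (A k).indicator x ∉ C} ⟨k, hk⟩
    refine Set.mem_iUnion.2 ⟨m, hm, fun j hj => ?_⟩
    by_contra hjC
    exact hmin j hjC hj
  have hhalf : ∀ k, ν (T k) ≤ 2 * ν (T k ∩ Cᶜ) := by
    intro k
    set R : (ι → ℝ) → ι → ℝ := fun x i => (A k).indicator x i - (A k)ᶜ.indicator x i with hR
    have hRp : MeasurePreserving R ν ν := hν (A k)
    have hRA : ∀ j ≤ k, ∀ x, (A j).indicator (R x) = (A j).indicator x := by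
      intro j hj x
      ext i
      by_cases hi : i ∈ A j
      · simp [hi, hR, hA hj hi]
      · simp [hi]
    have hRT : R ⁻¹' (T k ∩ Cᶜ) = T k ∩ R ⁻¹' Cᶜ := by
      ext x
      simp only [hT, Set.mem_preimage, Set.mem_inter_iff, Set.mem_ofPred_eq, hRA k le_rfl x]
      refine and_congr_left fun _ => and_congr_right fun _ => forall_congr' fun j => ?_
      exact imp_congr_right fun hj => by rw [hRA j hj.le x]
    have hsub : T k ⊆ (T k ∩ Cᶜ) ∪ R ⁻¹' (T k ∩ Cᶜ) := by
      intro x hx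
      rw [hRT]
      by_contra hcon
      simp only [Set.mem_union, Set.mem_inter_iff, hx, true_and, Set.mem_compl_iff,
        Set.mem_preimage, not_or, not_not] at hcon
      apply hx.1
      have hmid : midpoint ℝ x (R x) = (A k).indicator x := by
        ext i
        by_cases hi : i ∈ A k
        · simp [hR, hi]
        · simp [midpoint_eq_smul_add, hR, hi]
      rw [← hmid]
      exact hC.midpoint_mem hcon.1 hcon.2
    calc ν (T k) ≤ ν (T k ∩ Cᶜ) + ν (R ⁻¹' (T k ∩ Cᶜ)) :=
          (measure_mono hsub).trans (measure_union_le _ _)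
      _ = 2 * ν (T k ∩ Cᶜ) := by
          rw [hRp.measure_preimage ((hTm k).inter hCm.compl).nullMeasurableSet, two_mul]
  calc ν {x | ∃ k, (A k).indicator x ∉ C} ≤ ∑ k, ν (T k) :=
        (measure_mono hcover).trans (measure_iUnion_fintype_le _ _)
    _ ≤ ∑ k, 2 * ν (T k ∩ Cᶜ) := Finset.sum_le_sum fun k _ => hhalf k
    _ = 2 * ν (⋃ k, T k ∩ Cᶜ) := by
        rw [← Finset.mul_sum, measure_iUnion (fun k l hkl =>
          (hTd hkl).mono Set.inter_subset_left Set.inter_subset_left)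
          (fun k => (hTm k).inter hCm.compl), tsum_fintype]
    _ ≤ 2 * ν Cᶜ := by
        gcongr
        exact Set.iUnion_subset fun k => Set.inter_subset_right

/-- The vectors indexed by a `d`-dimensional array for which all sums over lower boxes in the
coordinates of `J` (with no restriction in the other coordinates) are at most `r` in absolute
value. -/
def boundedPartialSums {d : ℕ} {κ : Type*} [Fintype κ] [LinearOrder κ] (r : ℝ)
    (J : Finset (Fin d)) : Set ((Fin d → κ) → ℝ) :=
  {x | ∀ k : Fin d → κ, |∑ c, {c : Fin d → κ | ∀ i ∈ J, c i ≤ k i}.indicator x c| ≤ r}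

section

variable {d : ℕ} {κ : Type*} [Fintype κ] [LinearOrder κ]

theorem measurableSet_boundedPartialSums (r : ℝ) (J : Finset (Fin d)) :
    MeasurableSet (boundedPartialSums (κ := κ) r J) := by
  simp only [boundedPartialSums, Set.ofPred_forall]
  refine MeasurableSet.iInter fun k => ?_
  refine measurableSet_le ((Finset.measurable_sum _ fun c _ => ?_).abs) measurable_const
  exact (measurable_pi_apply c).comp (measurable_set_indicator _)

theorem convex_boundedPartialSums (r : ℝ) (J : Finset (Fin d)) :
    Convex ℝ (boundedPartialSums (κ := κ) r J) := by
  intro x hx y hy a b ha hb hab k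
  have h : ∑ c, {c : Fin d → κ | ∀ i ∈ J, c i ≤ k i}.indicator (a • x + b • y) c =
      a * ∑ c, {c : Fin d → κ | ∀ i ∈ J, c i ≤ k i}.indicator x c +
      b * ∑ c, {c : Fin d → κ | ∀ i ∈ J, c i ≤ k i}.indicator y c := by
    rw [Finset.mul_sum, Finset.mul_sum, ← Finset.sum_add_distrib]
    refine Finset.sum_congr rfl fun c _ => ?_
    by_cases hc : c ∈ {c : Fin d → κ | ∀ i ∈ J, c i ≤ k i}
    · simp only [Set.indicator_of_mem hc, Pi.add_apply, Pi.smul_apply, smul_eq_mul]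
    · simp only [Set.indicator_of_notMem hc, mul_zero, add_zero]
  rw [h]
  calc _ ≤ a * |∑ c, {c : Fin d → κ | ∀ i ∈ J, c i ≤ k i}.indicator x c| +
        b * |∑ c, {c : Fin d → κ | ∀ i ∈ J, c i ≤ k i}.indicator y c| := by
        refine (abs_add_le _ _).trans_eq ?_
        rw [abs_mul, abs_mul, abs_of_nonneg ha, abs_of_nonneg hb]
    _ ≤ a * r + b * r := by gcongr; exacts [hx k, hy k]
    _ = r := by rw [← add_mul, hab, one_mul]

/-- Lévy's maximal inequality for the partial sums of a `d`-dimensional array: the one-dimensional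
inequality, applied to one coordinate at a time with the sums over the remaining coordinates as a
norm, loses a factor `2` per coordinate. -/
theorem SignInvariant.measure_compl_boundedPartialSums_le {ν : Measure ((Fin d → κ) → ℝ)}
    (hν : SignInvariant ν) (r : ℝ) (J : Finset (Fin d)) :
    ν (boundedPartialSums r J)ᶜ ≤ 2 ^ J.card * ν {x | r < |∑ c, x c|} := by
  classical
  induction J using Finset.induction_on with
  | empty =>
    rw [Finset.card_empty, pow_zero, one_mul]
    refine measure_mono fun x hx => ?_
    simp only [boundedPartialSums, Set.mem_compl_iff, Set.mem_ofPred_eq, not_forall, not_le] at hx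
    obtain ⟨k, hk⟩ := hx
    simpa using hk
  | insert j J hj ih =>
    have hA : Monotone fun m : κ => {c : Fin d → κ | c j ≤ m} := fun m n hmn c hc =>
      le_trans hc hmn
    have hsub : (boundedPartialSums (κ := κ) r (insert j J))ᶜ ⊆
        {x | ∃ m : κ, {c : Fin d → κ | c j ≤ m}.indicator x ∉ boundedPartialSums r J} := by
      intro x hx
      by_contra hcon
      simp only [Set.mem_ofPred_eq, not_exists, not_not] at hcon
      refine hx fun k => ?_
      have hset : {c : Fin d → κ | ∀ i ∈ insert j J, c i ≤ k i} =
          {c | ∀ i ∈ J, c i ≤ k i} ∩ {c | c j ≤ k j} := by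
        ext c
        simp [and_comm]
      have h := hcon (k j) k
      simp only [Set.indicator_indicator] at h
      rwa [hset]
    calc ν (boundedPartialSums r (insert j J))ᶜ
        ≤ 2 * ν (boundedPartialSums r J)ᶜ := (measure_mono hsub).trans
          (hν.measure_exists_indicator_notMem_le hA (measurableSet_boundedPartialSums r J)
            (convex_boundedPartialSums r J))
      _ ≤ 2 * (2 ^ J.card * ν {x | r < |∑ c, x c|}) := by gcongr
      _ = 2 ^ (insert j J).card * ν {x | r < |∑ c, x c|} := by
        rw [Finset.card_insert_of_notMem hj, pow_succ', mul_assoc]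

end

/-! ### Symmetric stable laws and random measures -/

section

variable {Ω E : Type*} [MeasurableSpace Ω] [MeasurableSpace E] {α : ℝ} {P : Measure Ω}
  [IsProbabilityMeasure P]

theorem HasSymmetricStableLaw.map_neg {σ : ℝ} {X : Ω → ℝ} (h : HasSymmetricStableLaw α σ P X)
    (hX : Measurable X) : (P.map X).map (fun x => -x) = P.map X := by
  have := Measure.isProbabilityMeasure_map (μ := P) hX.aemeasurable
  have : IsProbabilityMeasure ((P.map X).map (fun x => -x)) :=
    Measure.isProbabilityMeasure_map measurable_neg.aemeasurable
  refine Measure.ext_of_charFun (funext fun t => ?_)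
  have := charFun_map_mul (μ := P.map X) (-1) t
  simp only [neg_one_mul] at this
  rw [this, h, h, abs_neg]

/-- A symmetric stable law with scale `σ` is the law of `σ Z`, where `Z` has scale `1`. -/
theorem HasSymmetricStableLaw.map_eq_map_mul {σ : ℝ} (hσ : 0 ≤ σ) {X Z : Ω → ℝ}
    (hX : HasSymmetricStableLaw α σ P X) (hXm : Measurable X)
    (hZ : HasSymmetricStableLaw α 1 P Z) (hZm : Measurable Z) :
    P.map X = P.map (fun ω => σ * Z ω) := by
  have := Measure.isProbabilityMeasure_map (μ := P) hXm.aemeasurable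
  have := Measure.isProbabilityMeasure_map (μ := P) (hZm.const_mul σ).aemeasurable
  have hmap : P.map (fun ω => σ * Z ω) = (P.map Z).map (fun x => σ * x) := by
    rw [Measure.map_map (measurable_const_mul σ) hZm]; rfl
  refine Measure.ext_of_charFun (funext fun t => ?_)
  rw [hmap, charFun_map_mul, hX, hZ, abs_mul, abs_of_nonneg hσ,
    Real.mul_rpow hσ (abs_nonneg t), Real.one_rpow, one_mul]

theorem HasSymmetricStableLaw.ae_eq_zero (hα : α ≠ 0) {X : Ω → ℝ}
    (h : HasSymmetricStableLaw α 0 P X) (hX : Measurable X) : ∀ᵐ ω ∂P, X ω = 0 := by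
  have := Measure.isProbabilityMeasure_map (μ := P) hX.aemeasurable
  have hd : P.map X = Measure.dirac 0 := by
    refine Measure.ext_of_charFun (funext fun t => ?_)
    rw [h t]
    simp [charFun_dirac, Real.zero_rpow hα]
  have : ∀ᵐ x ∂(P.map X), x = 0 := by
    rw [hd, ae_dirac_eq]; simp
  exact ae_of_ae_map hX.aemeasurable this

namespace IsSymmetricStableRandomMeasure

variable {m : Measure E} [IsFiniteMeasure m] {M : Set E → Ω → ℝ}

theorem ae_eq_zero_of_null (hα : α ≠ 0) (hM : IsSymmetricStableRandomMeasure α m P M)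
    {A : Set E} (hA : MeasurableSet A) (h0 : m A = 0) : ∀ᵐ ω ∂P, M A ω = 0 := by
  have h := hM.stable A hA (measure_lt_top _ _)
  rw [h0, ENNReal.toReal_zero, Real.zero_rpow (one_div_ne_zero hα)] at h
  exact h.ae_eq_zero hα (hM.measurable A hA (measure_lt_top _ _))

theorem ae_union (hα : α ≠ 0) (hM : IsSymmetricStableRandomMeasure α m P M)
    {A B : Set E} (hA : MeasurableSet A) (hB : MeasurableSet B) (hd : Disjoint A B) :
    ∀ᵐ ω ∂P, M (A ∪ B) ω = M A ω + M B ω := by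
  set S : ℕ → Set E := fun j => if j = 0 then A else if j = 1 then B else ∅ with hS
  have hSm : ∀ j, MeasurableSet (S j) := by
    intro j
    simp only [hS]
    split_ifs <;> [exact hA; exact hB; exact MeasurableSet.empty]
  have hSd : Pairwise (Function.onFun Disjoint S) := by
    intro i j hij
    simp only [Function.onFun, hS]
    split_ifs <;> first | omega | exact hd | exact hd.symm | simp
  have hU : ⋃ j, S j = A ∪ B := by
    ext x
    simp only [Set.mem_iUnion, Set.mem_union]
    constructor
    · rintro ⟨j, hj⟩
      simp only [hS] at hj
      split_ifs at hj <;> [exact Or.inl hj; exact Or.inr hj; exact absurd hj (by simp)]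
    · rintro (h | h)
      · exact ⟨0, by simpa [hS] using h⟩
      · exact ⟨1, by simpa [hS] using h⟩
  filter_upwards [hM.tendsto_sum S hSm hSd (measure_lt_top _ _),
    hM.ae_eq_zero_of_null hα MeasurableSet.empty measure_empty] with ω hω h0
  rw [hU] at hω
  refine tendsto_nhds_unique hω (tendsto_const_nhds.congr' ?_)
  filter_upwards [eventually_ge_atTop 2] with n hn
  obtain ⟨k, rfl⟩ := Nat.exists_eq_add_of_le hn
  rw [Finset.sum_range_add]
  have h2 : ∀ x, ¬ 2 + x = 1 := fun x => by omega
  simp [hS, Finset.sum_range_succ, h0, h2]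

theorem ae_biUnion (hα : α ≠ 0) (hM : IsSymmetricStableRandomMeasure α m P M) {ι : Type*}
    {A : ι → Set E} (hA : ∀ i, MeasurableSet (A i)) (hd : Pairwise (Function.onFun Disjoint A))
    (s : Finset ι) : ∀ᵐ ω ∂P, M (⋃ i ∈ s, A i) ω = ∑ i ∈ s, M (A i) ω := by
  classical
  induction s using Finset.induction_on with
  | empty =>
    simpa using hM.ae_eq_zero_of_null hα MeasurableSet.empty measure_empty
  | insert i s hi ih =>
    have hdis : Disjoint (A i) (⋃ j ∈ s, A j) := by
      simp only [Set.disjoint_iUnion_right]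
      exact fun j hj => hd fun h => hi (h ▸ hj)
    filter_upwards [ih, hM.ae_union hα (hA i) (s.measurableSet_biUnion fun j _ => hA j) hdis]
      with ω h1 h2
    rw [Finset.set_biUnion_insert, h2, h1, Finset.sum_insert hi]

theorem ae_eq_add_diff (hα : α ≠ 0) (hM : IsSymmetricStableRandomMeasure α m P M)
    {A B : Set E} (hA : MeasurableSet A) (hB : MeasurableSet B) (hBA : B ⊆ A) :
    ∀ᵐ ω ∂P, M A ω = M B ω + M (A \ B) ω := by
  have h := hM.ae_union hα hB (hA.diff hB) Set.disjoint_sdiff_right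
  rwa [Set.union_sdiff_cancel hBA] at h

/-- A symmetric stable random measure is almost surely continuous from above along a decreasing
sequence of sets: the consecutive differences are disjoint, and their series telescopes. -/
theorem ae_tendsto_iInter (hα : α ≠ 0) (hM : IsSymmetricStableRandomMeasure α m P M)
    {A : ℕ → Set E} (hA : ∀ n, MeasurableSet (A n)) (hanti : Antitone A) :
    ∀ᵐ ω ∂P, Tendsto (fun n => M (A n) ω) atTop (𝓝 (M (⋂ n, A n) ω)) := by
  set B : ℕ → Set E := fun n => A n \ A (n + 1) with hB
  have hBm : ∀ n, MeasurableSet (B n) := fun n => (hA n).diff (hA _)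
  have hBd : Pairwise (Function.onFun Disjoint B) := by
    have key : ∀ i j, i < j → Disjoint (B i) (B j) := fun i j hij =>
      Set.disjoint_left.2 fun x hi hj => hi.2 (hanti (Nat.succ_le_of_lt hij) hj.1)
    intro i j hij
    rcases lt_or_gt_of_ne hij with h | h
    exacts [key i j h, (key j i h).symm]
  have hU : ⋃ n, B n = A 0 \ ⋂ n, A n := by
    classical
    ext x
    simp only [Set.mem_iUnion, Set.mem_sdiff, Set.mem_iInter, not_forall, hB]
    constructor
    · rintro ⟨n, hn, hn'⟩
      exact ⟨hanti (Nat.zero_le n) hn, n + 1, hn'⟩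
    · rintro ⟨h0, hn⟩
      obtain ⟨k, hk⟩ : ∃ k, Nat.find hn = k + 1 :=
        Nat.exists_eq_succ_of_ne_zero fun h => Nat.find_spec hn (h ▸ h0)
      exact ⟨k, not_not.1 (Nat.find_min hn (hk ▸ Nat.lt_succ_self k)), hk ▸ Nat.find_spec hn⟩
  have hstep : ∀ᵐ ω ∂P, ∀ n, M (A n) ω = M (A (n + 1)) ω + M (B n) ω :=
    ae_all_iff.2 fun n => hM.ae_eq_add_diff hα (hA n) (hA _) (hanti n.le_succ)
  filter_upwards [hM.tendsto_sum B hBm hBd (measure_lt_top _ _), hstep,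
    hM.ae_eq_add_diff hα (hA 0) (MeasurableSet.iInter hA) (Set.iInter_subset A 0)] with ω h1 h2 h3
  rw [hU] at h1
  have h4 : ∀ n, M (A n) ω = M (A 0) ω - ∑ j ∈ Finset.range n, M (B j) ω := by
    intro n
    induction n with
    | zero => simp
    | succ n ih => rw [Finset.sum_range_succ]; linarith [h2 n]
  have h5 := h1.const_sub (M (A 0) ω)
  simp only [← h4] at h5
  rwa [show M (⋂ n, A n) ω = M (A 0) ω - M (A 0 \ ⋂ n, A n) ω by linarith]

end IsSymmetricStableRandomMeasure

/-- A symmetric stable random measure is continuous in probability along sets `A n ⊇ B` whose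
measures converge to that of `B`, because the scale of `M (A n \ B)` tends to zero. -/
theorem IsSymmetricStableRandomMeasure.tendstoInMeasure (hα : 0 < α) {m : Measure E}
    [IsProbabilityMeasure m] {M : Set E → Ω → ℝ} (hM : IsSymmetricStableRandomMeasure α m P M)
    {A : ℕ → Set E} {B : Set E} (hA : ∀ n, MeasurableSet (A n)) (hB : MeasurableSet B)
    (hBA : ∀ n, B ⊆ A n) (hlim : Tendsto (fun n => m (A n)) atTop (𝓝 (m B))) :
    TendstoInMeasure P (fun n => M (A n)) atTop (M B) := by
  have hfin : ∀ A, m A < ∞ := measure_lt_top m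
  set σ : ℕ → ℝ := fun n => (m (A n \ B)).toReal ^ (1 / α) with hσ
  have hσ0 : Tendsto σ atTop (𝓝 0) := by
    have h1 : Tendsto (fun n => m (A n \ B)) atTop (𝓝 0) := by
      have h := ENNReal.Tendsto.sub hlim (tendsto_const_nhds (x := m B)) (Or.inl (hfin B).ne)
      rw [tsub_self] at h
      refine h.congr fun n => ?_
      rw [measure_sdiff (hBA n) hB.nullMeasurableSet (hfin B).ne]
    have h2 := (ENNReal.tendsto_toReal ENNReal.zero_ne_top).comp h1
    have h3 := h2.rpow_const (p := 1 / α) (Or.inr (by positivity))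
    simpa [hσ, Real.zero_rpow (inv_ne_zero hα.ne')] using h3
  have hZ : HasSymmetricStableLaw α 1 P (M Set.univ) := by
    have h := hM.stable Set.univ MeasurableSet.univ (hfin _)
    simpa using h
  have hZm := hM.measurable Set.univ MeasurableSet.univ (hfin _)
  have hlimZ : TendstoInMeasure P (fun n ω => σ n * M Set.univ ω) atTop fun _ => (0 : ℝ) := by
    refine tendstoInMeasure_of_tendsto_ae (fun n => (hZm.const_mul _).aestronglyMeasurable) ?_
    refine ae_of_all _ fun ω => ?_
    simpa using hσ0.mul_const (M Set.univ ω)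
  rw [tendstoInMeasure_iff_dist] at hlimZ ⊢
  intro ε hε
  refine (hlimZ ε hε).congr fun n => ?_
  have hDm := (hA n).diff hB
  have hlaw := (hM.stable _ hDm (hfin _)).map_eq_map_mul (by positivity)
    (hM.measurable _ hDm (hfin _)) hZ hZm
  have hset : MeasurableSet {x : ℝ | ε ≤ dist x 0} :=
    measurableSet_le measurable_const (measurable_id.dist measurable_const)
  have h1 := congrArg (fun ν => ν {x : ℝ | ε ≤ dist x 0}) hlaw
  simp only [Measure.map_apply (hM.measurable _ hDm (hfin _)) hset,
    Measure.map_apply (hZm.const_mul _) hset] at h1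
  refine h1.symm.trans (measure_congr ?_)
  filter_upwards [hM.ae_eq_add_diff hα.ne' (hA n) hB (hBA n)] with ω hω
  refine propext ?_
  change ε ≤ dist (M (A n \ B) ω) 0 ↔ ε ≤ dist (M (A n) ω) (M B ω)
  rw [hω, Real.dist_eq, Real.dist_eq, sub_zero, add_sub_cancel_left]

end

/-! ### The grids of mesh `1 / N` -/

/-- The integer coordinates `⌈N x i⌉` of the grid point to which `x` is rounded up. -/
noncomputable def gridIndex {d : ℕ} (N : ℕ+) (x : Cube d) : Fin d → Fin ((N : ℕ) + 1) := fun i =>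
  ⟨⌈(x i : ℝ) * N⌉₊, by
    rw [Nat.lt_add_one_iff, Nat.ceil_le]
    exact mul_le_of_le_one_left (Nat.cast_nonneg _) (x i).2.2⟩

/-- The grid point with integer coordinates `k`. -/
noncomputable def gridVertex {d : ℕ} (N : ℕ+) (k : Fin d → Fin ((N : ℕ) + 1)) : Cube d := fun i =>
  ⟨(k i : ℕ) / (N : ℝ), div_nonneg (Nat.cast_nonneg _) (Nat.cast_nonneg _),
    div_le_one_of_le₀ (by exact_mod_cast Nat.lt_add_one_iff.1 (k i).2) (Nat.cast_nonneg _)⟩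

section

variable {d : ℕ}

theorem gridPoint_eq_gridVertex (N : ℕ+) (x : Cube d) :
    gridPoint N x = gridVertex N (gridIndex N x) := by
  funext i
  apply Subtype.ext
  have h0 : 0 ≤ (x i : ℝ) * N := mul_nonneg (x i).2.1 (Nat.cast_nonneg _)
  simp only [gridPoint, gridVertex, gridIndex]
  rw [div_div_eq_mul_div, div_one, one_div_mul_eq_div, natCast_ceil_eq_intCast_ceil h0]

theorem le_gridVertex_iff {N : ℕ+} {x : Cube d} {k : Fin d → Fin ((N : ℕ) + 1)} :
    x ≤ gridVertex N k ↔ gridIndex N x ≤ k := by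
  have hN : (0 : ℝ) < N := by exact_mod_cast N.pos
  refine forall_congr' fun i => ?_
  rw [← Subtype.coe_le_coe, Fin.le_def]
  simp only [gridVertex, gridIndex]
  rw [Nat.ceil_le, le_div_iff₀ hN]

theorem le_gridPoint (N : ℕ+) (x : Cube d) : x ≤ gridPoint N x := by
  rw [gridPoint_eq_gridVertex, le_gridVertex_iff]

theorem gridPoint_le_add (N : ℕ+) (x : Cube d) (i : Fin d) :
    (gridPoint N x i : ℝ) ≤ x i + 1 / N := by
  have hN : (0 : ℝ) < N := by exact_mod_cast N.pos
  have h0 : 0 ≤ (x i : ℝ) * N := mul_nonneg (x i).2.1 (Nat.cast_nonneg _)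
  rw [gridPoint_eq_gridVertex]
  simp only [gridVertex, gridIndex]
  rw [div_le_iff₀ hN, add_mul, one_div_mul_cancel hN.ne']
  exact (Nat.ceil_lt_add_one h0).le

theorem monotone_gridVertex (N : ℕ+) : Monotone (gridVertex (d := d) N) := by
  intro k l hkl i
  rw [← Subtype.coe_le_coe]
  simp only [gridVertex]
  have h : ((k i : ℕ) : ℝ) ≤ (l i : ℕ) := by exact_mod_cast hkl i
  gcongr

theorem monotone_gridIndex (N : ℕ+) : Monotone (gridIndex (d := d) N) := by
  intro x y hxy
  rw [← le_gridVertex_iff, ← gridPoint_eq_gridVertex]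
  exact hxy.trans (le_gridPoint N y)

/-- The grid of mesh `1 / N` is contained in the grid of mesh `1 / (N K)`. -/
theorem gridPoint_mul_gridPoint (N K : ℕ+) (x : Cube d) :
    gridPoint (N * K) (gridPoint N x) = gridPoint N x := by
  have hN : (0 : ℝ) < N := by exact_mod_cast N.pos
  refine le_antisymm (fun i => ?_) (le_gridPoint _ _)
  rw [gridPoint_eq_gridVertex (N * K), ← Subtype.coe_le_coe, gridPoint_eq_gridVertex N]
  simp only [gridVertex, gridIndex, PNat.mul_coe, Nat.cast_mul]
  rw [show (⌈(x i : ℝ) * N⌉₊ : ℝ) / N * (N * K) = ((⌈(x i : ℝ) * N⌉₊ * K : ℕ) : ℝ) by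
    push_cast; field_simp, Nat.ceil_natCast]
  apply le_of_eq
  push_cast
  have hK : (0 : ℝ) < K := by exact_mod_cast K.pos
  field_simp

/-- Refining a grid decreases the point to which `x` is rounded up. -/
theorem gridPoint_mul_le (N K : ℕ+) (x : Cube d) : gridPoint (N * K) x ≤ gridPoint N x := by
  rw [← gridPoint_mul_gridPoint N K x, gridPoint_eq_gridVertex (N * K) x,
    gridPoint_eq_gridVertex (N * K) (gridPoint N x)]
  exact monotone_gridVertex _ (monotone_gridIndex _ (le_gridPoint N x))

theorem measurable_gridIndex (N : ℕ+) : Measurable (gridIndex (d := d) N) := by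
  refine measurable_pi_lambda _ fun i => ?_
  have h : Measurable fun x : Cube d => ⌈(x i : ℝ) * N⌉₊ := by fun_prop
  refine measurable_to_countable' fun k => ?_
  have : (fun x : Cube d => gridIndex N x i) ⁻¹' {k} =
      (fun x : Cube d => ⌈(x i : ℝ) * N⌉₊) ⁻¹' {(k : ℕ)} := by
    ext x
    simp [gridIndex, Fin.ext_iff]
  rw [this]
  exact h (measurableSet_singleton _)

theorem measurable_gridPoint (N : ℕ+) : Measurable (gridPoint (d := d) N) := by
  rw [show gridPoint (d := d) N = gridVertex N ∘ gridIndex N from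
    funext (gridPoint_eq_gridVertex N)]
  exact (measurable_of_countable _).comp (measurable_gridIndex N)

theorem tendsto_gridPoint {ns : ℕ → ℕ+} (hns : Tendsto ns atTop atTop) (x : Cube d) :
    Tendsto (fun n => gridPoint (ns n) x) atTop (𝓝 x) := by
  rw [tendsto_pi_nhds]
  intro i
  rw [tendsto_subtype_rng]
  have h : Tendsto (fun n => (x i : ℝ) + 1 / ((ns n : ℕ) : ℝ)) atTop (𝓝 (x i + 0)) :=
    tendsto_const_nhds.add
      ((tendsto_one_div_atTop_nhds_zero_nat (𝕜 := ℝ)).comp (tendsto_PNat_val_atTop_atTop.comp hns))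
  rw [add_zero] at h
  exact tendsto_of_tendsto_of_tendsto_of_le_of_le tendsto_const_nhds h
    (fun n => le_gridPoint _ _ i) (fun n => gridPoint_le_add _ _ i)

theorem Cube.volume_Iic (x : Cube d) :
    (volume : Measure (Cube d)) (Set.Iic x) = ∏ i, ENNReal.ofReal (x i) := by
  rw [← Set.pi_univ_Iic, volume_pi_pi]
  simp only [unitInterval.volume_Iic]

theorem continuous_volume_Iic :
    Continuous fun x : Cube d => (volume : Measure (Cube d)) (Set.Iic x) := by
  have h : ∀ x : Cube d, (volume : Measure (Cube d)) (Set.Iic x) =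
      ENNReal.ofReal (∏ i, (x i : ℝ)) := fun x => by
    rw [Cube.volume_Iic, ENNReal.ofReal_prod_of_nonneg fun i _ => (x i).2.1]
  simp only [h]
  refine ENNReal.continuous_ofReal.comp ?_
  fun_prop

theorem tendsto_two_pow_pnat : Tendsto (fun k : ℕ => (2 : ℕ+) ^ k) atTop atTop := by
  refine tendsto_atTop_mono (f := fun k : ℕ => k.toPNat') ?_ ?_
  · intro k
    rw [← PNat.coe_le_coe, PNat.pow_coe]
    rcases k.eq_zero_or_pos with rfl | hk
    · simp
    · rw [Nat.toPNat'_coe, if_pos hk]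
      exact Nat.lt_two_pow_self.le
  · refine tendsto_atTop_atTop.2 fun b => ⟨b, fun a ha => ?_⟩
    rw [← PNat.coe_le_coe, Nat.toPNat'_coe, if_pos (lt_of_lt_of_le b.pos ha)]
    exact ha

/-! ### The stable sheet on the grids -/

namespace IsSymmetricStableRandomMeasure

variable {Ω : Type*} [MeasurableSpace Ω] {α : ℝ} {P : Measure Ω} [IsProbabilityMeasure P]
  {M : Set (Cube d) → Ω → ℝ}

/-- Maximal inequality for the sheet on the grid of mesh `1 / N`: its values are the sums over
lower boxes of the independent symmetric values of `M` on the cells. The bound does not depend on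
`N`. -/
theorem measure_exists_gridVertex_le (hα : 0 < α)
    (hM : IsSymmetricStableRandomMeasure α (volume : Measure (Cube d)) P M) (N : ℕ+) (r : ℝ) :
    P {ω | ∃ k, r < |M (Set.Iic (gridVertex N k)) ω|} ≤
      2 ^ d * P {ω | r < |M Set.univ ω|} := by
  classical
  set cell : (Fin d → Fin ((N : ℕ) + 1)) → Set (Cube d) := fun c => gridIndex N ⁻¹' {c} with hcell
  have hcm : ∀ c, MeasurableSet (cell c) := fun c =>
    measurable_gridIndex N (measurableSet_singleton c)
  have hcd : Pairwise (Function.onFun Disjoint cell) := fun c c' h =>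
    (Set.disjoint_singleton.2 h).preimage _
  have hfin : ∀ A : Set (Cube d), volume A < ∞ := measure_lt_top volume
  have hXm : ∀ c, Measurable (M (cell c)) := fun c => hM.measurable _ (hcm c) (hfin _)
  have hXi : iIndepFun (fun c => M (cell c)) P := by
    set e := Fintype.equivFin (Fin d → Fin ((N : ℕ) + 1))
    have h := hM.indep _ (fun j => cell (e.symm j)) (fun j => hcm _) (fun j => hfin _)
      (fun i j hij => hcd (e.symm.injective.ne hij))
    have h' := h.precomp e.injective
    simpa using h'
  set ν : Measure ((Fin d → Fin ((N : ℕ) + 1)) → ℝ) := P.map fun ω c => M (cell c) ω with hν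
  have hsign : SignInvariant ν := signInvariant_map_of_iIndepFun hXm hXi fun c =>
    (hM.stable _ (hcm c) (hfin _)).map_neg (hXm c)
  have hvm : Measurable fun ω c => M (cell c) ω := measurable_pi_lambda _ hXm
  have hmax := hsign.measure_compl_boundedPartialSums_le r Finset.univ
  have hS : MeasurableSet {x : (Fin d → Fin ((N : ℕ) + 1)) → ℝ | r < |∑ c, x c|} :=
    measurableSet_lt measurable_const
      (Finset.measurable_sum _ fun c _ => measurable_pi_apply c).abs
  rw [hν, Measure.map_apply hvm (measurableSet_boundedPartialSums r _).compl,
    Measure.map_apply hvm hS, Finset.card_univ, Fintype.card_fin] at hmax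
  have hsum : ∀ s : Finset (Fin d → Fin ((N : ℕ) + 1)), ∀ᵐ ω ∂P,
      M (gridIndex N ⁻¹' (s : Set _)) ω = ∑ c ∈ s, M (cell c) ω := by
    intro s
    have h := hM.ae_biUnion hα.ne' hcm hcd s
    rwa [show ⋃ c ∈ s, cell c = gridIndex N ⁻¹' (s : Set _) by ext x; simp [hcell]] at h
  have hIic : ∀ᵐ ω ∂P, ∀ k, M (Set.Iic (gridVertex N k)) ω =
      ∑ c, {c : Fin d → Fin ((N : ℕ) + 1) | ∀ i ∈ Finset.univ, c i ≤ k i}.indicator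
        (fun c => M (cell c) ω) c := by
    refine ae_all_iff.2 fun k => ?_
    filter_upwards [hsum (Finset.univ.filter fun c => c ≤ k)] with ω hω
    rw [Finset.sum_filter] at hω
    convert hω using 2
    · ext x
      simp [le_gridVertex_iff]
    · simp [Set.indicator_apply, Pi.le_def]
  have huniv : ∀ᵐ ω ∂P, M Set.univ ω = ∑ c, M (cell c) ω := by
    simpa using hsum Finset.univ
  refine le_trans (measure_mono_ae ?_) (hmax.trans_eq ?_)
  · filter_upwards [hIic] with ω hω
    rintro ⟨k, hk⟩ hmem
    exact absurd (hmem k) (not_le.2 (hω k ▸ hk))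
  · congr 1
    refine measure_congr ?_
    filter_upwards [huniv] with ω hω
    refine propext ?_
    change r < |∑ c, M (cell c) ω| ↔ r < |M Set.univ ω|
    rw [hω]

/-- Almost surely, the values of the sheet at the points of all the grids together are bounded. -/
theorem ae_exists_forall_gridPoint_le (hα : 0 < α)
    (hM : IsSymmetricStableRandomMeasure α (volume : Measure (Cube d)) P M) :
    ∀ᵐ ω ∂P, ∃ r : ℝ, ∀ (N : ℕ+) (x : Cube d), |M (Set.Iic (gridPoint N x)) ω| ≤ r := by
  set B : ℝ → ℕ+ → Set Ω := fun r N => {ω | ∃ x : Cube d, r < |M (Set.Iic (gridPoint N x)) ω|}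
    with hB
  have hBle : ∀ r, P (⋃ N, B r N) ≤ 2 ^ d * P {ω | r < |M Set.univ ω|} := by
    intro r
    -- the grids are directed under refinement, so that the bound for one grid passes to the union
    have hdir : Directed (· ⊆ ·) (B r) := by
      have hmul : ∀ N K, B r N ⊆ B r (N * K) := by
        rintro N K ω ⟨x, hx⟩
        exact ⟨gridPoint N x, by rwa [gridPoint_mul_gridPoint]⟩
      exact fun N K => ⟨N * K, hmul N K, mul_comm N K ▸ hmul K N⟩
    rw [hdir.measure_iUnion]
    refine iSup_le fun N => le_trans (measure_mono ?_) (hM.measure_exists_gridVertex_le hα N r)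
    rintro ω ⟨x, hx⟩
    exact ⟨gridIndex N x, by rwa [← gridPoint_eq_gridVertex]⟩
  have hZ : Measurable (M Set.univ) := hM.measurable _ MeasurableSet.univ (measure_lt_top _ _)
  have htail : Tendsto (fun n : ℕ => P {ω | (n : ℝ) < |M Set.univ ω|}) atTop (𝓝 0) := by
    have h := tendsto_measure_iInter_atTop (μ := P)
      (s := fun n : ℕ => {ω | (n : ℝ) < |M Set.univ ω|})
      (fun n => (measurableSet_lt measurable_const hZ.abs).nullMeasurableSet)
      (fun n k hnk ω (hω : (k : ℝ) < _) => lt_of_le_of_lt (Nat.cast_le.2 hnk) hω)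
      ⟨0, measure_ne_top _ _⟩
    rwa [show ⋂ n : ℕ, {ω | (n : ℝ) < |M Set.univ ω|} = ∅ by
      refine Set.eq_empty_of_forall_notMem fun ω hω => ?_
      obtain ⟨n, hn⟩ := exists_nat_ge |M Set.univ ω|
      exact absurd (Set.mem_iInter.1 hω n) (not_lt.2 hn), measure_empty] at h
  have hlim : Tendsto (fun n : ℕ => 2 ^ d * P {ω | (n : ℝ) < |M Set.univ ω|}) atTop (𝓝 0) := by
    have h := ENNReal.Tendsto.const_mul (a := 2 ^ d) htail (Or.inr (by simp))
    rwa [mul_zero] at h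
  rw [ae_iff]
  refine le_antisymm (ge_of_tendsto' hlim fun n => le_trans (measure_mono ?_) (hBle n)) zero_le
  intro ω hω
  simp only [Set.mem_ofPred_eq, not_exists, not_forall, not_le] at hω
  obtain ⟨N, x, hx⟩ := hω n
  exact Set.mem_iUnion.2 ⟨N, x, hx⟩

/-- Along the dyadic grids, which refine each other, the sheet at the rounded points converges
almost surely at every point. -/
theorem ae_tendsto_gridPoint_two_pow (hα : 0 < α)
    (hM : IsSymmetricStableRandomMeasure α (volume : Measure (Cube d)) P M) (x : Cube d) :
    ∀ᵐ ω ∂P, Tendsto (fun k : ℕ => M (Set.Iic (gridPoint (2 ^ k) x)) ω) atTop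
      (𝓝 (M (Set.Iic x) ω)) := by
  have hanti : Antitone fun k : ℕ => Set.Iic (gridPoint (2 ^ k) x) :=
    antitone_nat_of_succ_le fun k => Set.Iic_subset_Iic.2 (by
      rw [pow_succ]; exact gridPoint_mul_le _ _ _)
  have h := hM.ae_tendsto_iInter hα.ne' (fun k => measurableSet_Iic) hanti
  have hinter : ⋂ k : ℕ, Set.Iic (gridPoint (2 ^ k) x) = Set.Iic x := by
    ext y
    simp only [Set.mem_iInter, Set.mem_Iic]
    exact ⟨fun hy => ge_of_tendsto' (tendsto_gridPoint tendsto_two_pow_pnat x) hy,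
      fun hy k => hy.trans (le_gridPoint _ _)⟩
  rwa [hinter] at h

end IsSymmetricStableRandomMeasure

/-- A stable sheet has a jointly measurable version: the upper limit of the sheet at the points
rounded up to the dyadic grids. -/
theorem IsStableSheet.exists_isMeasurableVersion {Ω : Type*} [MeasurableSpace Ω] {α : ℝ}
    (hα : 0 < α) {P : Measure Ω} [IsProbabilityMeasure P] {U : Cube d → Ω → ℝ}
    (hU : IsStableSheet d α P U) : ∃ V, IsMeasurableVersion P U V := by
  obtain ⟨M, hM, hUM⟩ := hU
  refine ⟨fun x ω => limsup (fun k : ℕ => M (Set.Iic (gridPoint (2 ^ k) x)) ω) atTop,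
    Measurable.limsup fun k => ?_, fun x => ?_⟩
  · have h : Measurable fun z : (Fin d → Fin (((2 ^ k : ℕ+) : ℕ) + 1)) × Ω =>
        M (Set.Iic (gridVertex (2 ^ k) z.1)) z.2 :=
      measurable_from_prod_countable_right fun c =>
        hM.measurable (Set.Iic (gridVertex (2 ^ k) c)) measurableSet_Iic (measure_lt_top _ _)
    have h' := h.comp (((measurable_gridIndex (2 ^ k)).comp measurable_fst).prodMk measurable_snd)
    simpa only [Function.comp_def, ← gridPoint_eq_gridVertex] using h'
  · filter_upwards [hM.ae_tendsto_gridPoint_two_pow hα x, hUM x] with ω h1 h2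
    rw [h2]
    exact h1.limsup_eq

end

/-! ### Convergence of the discretized paths in `L^p` -/

/-- Uniformly bounded functions on a finite measure space that converge almost everywhere converge
in `L^p`, `p < ∞`. -/
theorem tendsto_eLpNorm_sub_of_bounded {X : Type*} [MeasurableSpace X] {μ : Measure X}
    [IsFiniteMeasure μ] {p : ℝ≥0∞} (hp0 : p ≠ 0) (hp : p ≠ ∞) {f : ℕ → X → ℝ} {g : X → ℝ}
    (hf : ∀ n, Measurable (f n)) (hg : Measurable g) {r : ℝ} (hfr : ∀ n x, |f n x| ≤ r)
    (hgr : ∀ᵐ x ∂μ, |g x| ≤ r) (hlim : ∀ᵐ x ∂μ, Tendsto (fun n => f n x) atTop (𝓝 (g x))) :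
    Tendsto (fun n => eLpNorm (f n - g) p μ) atTop (𝓝 0) := by
  have hq : 0 < p.toReal := ENNReal.toReal_pos hp0 hp
  simp only [eLpNorm_eq_lintegral_rpow_enorm_toReal hp0 hp]
  have key : Tendsto (fun n => ∫⁻ x, ‖(f n - g) x‖ₑ ^ p.toReal ∂μ) atTop (𝓝 (∫⁻ _, 0 ∂μ)) := by
    refine tendsto_lintegral_of_dominated_convergence
      (fun _ => ENNReal.ofReal (r + r) ^ p.toReal) (fun n => ?_) (fun n => ?_) ?_ ?_
    · exact (((hf n).sub hg).enorm).pow_const _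
    · filter_upwards [hgr] with x hx
      refine ENNReal.rpow_le_rpow ?_ hq.le
      rw [Pi.sub_apply, Real.enorm_eq_ofReal_abs]
      exact ENNReal.ofReal_le_ofReal ((abs_sub _ _).trans (add_le_add (hfr n x) hx))
    · rw [lintegral_const]
      exact ENNReal.mul_ne_top (ENNReal.rpow_ne_top_of_nonneg hq.le ENNReal.ofReal_ne_top)
        (measure_ne_top _ _)
    · filter_upwards [hlim] with x hx
      have h1 : Tendsto (fun n => ‖f n x - g x‖ₑ) atTop (𝓝 0) := by
        have h := (hx.sub_const (g x)).enorm
        simpa using h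
      have h2 := h1.ennrpow_const p.toReal
      rwa [ENNReal.zero_rpow_of_pos hq] at h2
  rw [lintegral_zero] at key
  have h := key.ennrpow_const (1 / p.toReal)
  rwa [ENNReal.zero_rpow_of_pos (by positivity)] at h

section

variable {d : ℕ}

theorem memLp_comp_gridIndex (p : ℝ≥0∞) {N : ℕ+} (a : (Fin d → Fin ((N : ℕ) + 1)) → ℝ) :
    MemLp (fun x => a (gridIndex N x)) p (volume : Measure (Cube d)) :=
  MemLp.of_bound ((measurable_of_countable a).comp (measurable_gridIndex N)).aestronglyMeasurable
    (∑ k, ‖a k‖) (ae_of_all _ fun _ =>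
      Finset.single_le_sum (f := fun k => ‖a k‖) (fun _ _ => norm_nonneg _) (Finset.mem_univ _))

/-- The step function on the cells of a grid with given values, as an element of `L^p`. -/
noncomputable def gridStepLp (d : ℕ) (p : ℝ≥0∞) (N : ℕ+) :
    ((Fin d → Fin ((N : ℕ) + 1)) → ℝ) →ₗ[ℝ] LpCube d p where
  toFun a := (memLp_comp_gridIndex p a).toLp _
  map_add' _ _ := rfl
  map_smul' _ _ := rfl

theorem lpPath_of_memLp {Ω : Type*} {V : Cube d → Ω → ℝ} {p : ℝ≥0∞} {ω : Ω}
    (h : MemLp (fun x => V x ω) p volume) : lpPath p V ω = h.toLp _ := dif_pos h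

theorem memLp_discretization {Ω : Type*} (p : ℝ≥0∞) (V : Cube d → Ω → ℝ) (N : ℕ+) (ω : Ω) :
    MemLp (fun x => discretization V N x ω) p volume := by
  simp only [discretization, gridPoint_eq_gridVertex]
  exact memLp_comp_gridIndex p fun k => V (gridVertex N k) ω

variable {Ω : Type*} [MeasurableSpace Ω] {α : ℝ} {P : Measure Ω} {V : Cube d → Ω → ℝ}

/-- The path of a discretization depends linearly, hence measurably, on finitely many values. -/
theorem measurable_lpPath_discretization (p : ℝ≥0∞) [Fact (1 ≤ p)]
    (hV : ∀ x, Measurable (V x)) (N : ℕ+) : Measurable (lpPath p (discretization V N)) := by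
  have h : lpPath p (discretization V N) =
      fun ω => gridStepLp d p N fun k => V (gridVertex N k) ω := by
    funext ω
    rw [lpPath_of_memLp (memLp_discretization p V N ω)]
    simp only [discretization, gridPoint_eq_gridVertex]
    rfl
  rw [h]
  exact (gridStepLp d p N).continuous_of_finiteDimensional.measurable.comp
    (measurable_pi_lambda _ fun k => hV _)

theorem isLpValued_discretization (p : ℝ≥0∞) [Fact (1 ≤ p)]
    (hVm : Measurable fun z : Cube d × Ω => V z.1 z.2) (N : ℕ+) :
    IsLpValued p P (discretization V N) :=
  ⟨ae_of_all _ (memLp_discretization p V N),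
    (measurable_lpPath_discretization p (fun _ => hVm.comp measurable_prodMk_left) N).aemeasurable⟩

variable [IsProbabilityMeasure P] {M : Set (Cube d) → Ω → ℝ}

/-- By continuity in probability of the sheet at every point, the discretizations converge in
measure on `[0,1]^d × Ω`. -/
theorem tendstoInMeasure_discretization (hα : 0 < α)
    (hM : IsSymmetricStableRandomMeasure α (volume : Measure (Cube d)) P M)
    (hVm : Measurable fun z : Cube d × Ω => V z.1 z.2) (hVM : ∀ x, V x =ᵐ[P] M (Set.Iic x))
    {ns : ℕ → ℕ+} (hns : Tendsto ns atTop atTop) :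
    TendstoInMeasure ((volume : Measure (Cube d)).prod P)
      (fun n z => discretization V (ns n) z.1 z.2) atTop fun z => V z.1 z.2 := by
  have hDm : ∀ N, Measurable fun z : Cube d × Ω => discretization V N z.1 z.2 := fun N =>
    hVm.comp (((measurable_gridPoint N).comp measurable_fst).prodMk measurable_snd)
  have hpt : ∀ x, TendstoInMeasure P (fun n => discretization V (ns n) x) atTop (V x) := by
    intro x
    refine TendstoInMeasure.congr (fun n => (hVM (gridPoint (ns n) x)).symm) (hVM x).symm ?_
    exact hM.tendstoInMeasure hα (fun n => measurableSet_Iic) measurableSet_Iic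
      (fun n => Set.Iic_subset_Iic.2 (le_gridPoint _ _))
      ((continuous_volume_Iic.tendsto x).comp (tendsto_gridPoint hns x))
  rw [tendstoInMeasure_iff_dist]
  intro ε hε
  have hS : ∀ n, MeasurableSet {z : Cube d × Ω |
      ε ≤ dist (discretization V (ns n) z.1 z.2) (V z.1 z.2)} := fun n =>
    measurableSet_le measurable_const ((hDm _).dist hVm)
  simp only [Measure.prod_apply (hS _)]
  have h := tendsto_lintegral_of_dominated_convergence (μ := (volume : Measure (Cube d)))
    (F := fun n x => P (Prod.mk x ⁻¹' {z : Cube d × Ω |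
      ε ≤ dist (discretization V (ns n) z.1 z.2) (V z.1 z.2)})) (f := fun _ => 0)
    (fun _ => 1) (fun n => measurable_measure_prodMk_left (hS n))
    (fun n => ae_of_all _ fun x => prob_le_one) (by simp)
    (ae_of_all _ fun x => (tendstoInMeasure_iff_dist.1 (hpt x)) ε hε)
  rwa [lintegral_zero] at h

/-- A measurable version of the sheet has paths in `L^p`, and some subsequence of any sequence of
discretizations converges to it in `L^p` almost surely. Along a subsequence the discretizations
converge at almost every point of `[0,1]^d × Ω`, and almost every path stays bounded on all grids,
so that dominated convergence applies path by path. -/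
theorem exists_ae_tendsto_lpPath_discretization (hα : 0 < α) {p : ℝ≥0∞} [Fact (1 ≤ p)]
    (hp : p ≠ ∞) (hM : IsSymmetricStableRandomMeasure α (volume : Measure (Cube d)) P M)
    (hVm : Measurable fun z : Cube d × Ω => V z.1 z.2) (hVM : ∀ x, V x =ᵐ[P] M (Set.Iic x))
    {ns : ℕ → ℕ+} (hns : Tendsto ns atTop atTop) :
    ∃ ms : ℕ → ℕ, ∀ᵐ ω ∂P, MemLp (fun x => V x ω) p (volume : Measure (Cube d)) ∧
      Tendsto (fun n => lpPath p (discretization V (ns (ms n))) ω) atTop (𝓝 (lpPath p V ω)) := by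
  obtain ⟨ms, -, hms⟩ :=
    (tendstoInMeasure_discretization hα hM hVm hVM hns).exists_seq_tendsto_ae
  refine ⟨ms, ?_⟩
  have hms' : ∀ᵐ ω ∂P, ∀ᵐ x ∂(volume : Measure (Cube d)),
      Tendsto (fun n => discretization V (ns (ms n)) x ω) atTop (𝓝 (V x ω)) :=
    Measure.ae_ae_of_ae_prod ((Measure.measurePreserving_swap (μ := P)
      (ν := (volume : Measure (Cube d)))).quasiMeasurePreserving.ae hms)
  have hgrid : ∀ᵐ ω ∂P, ∀ N k, V (gridVertex N k) ω = M (Set.Iic (gridVertex N k)) ω :=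
    ae_all_iff.2 fun N => ae_all_iff.2 fun k => hVM _
  filter_upwards [hms', hgrid, hM.ae_exists_forall_gridPoint_le hα] with ω hω hg ⟨r, hr⟩
  have hbound : ∀ N x, |discretization V N x ω| ≤ r := fun N x => by
    rw [discretization, gridPoint_eq_gridVertex, hg, ← gridPoint_eq_gridVertex]
    exact hr N x
  have hVr : ∀ᵐ x ∂(volume : Measure (Cube d)), |V x ω| ≤ r := by
    filter_upwards [hω] with x hx
    exact le_of_tendsto' hx.abs fun n => hbound _ x
  have hVω : Measurable fun x => V x ω := hVm.comp measurable_prodMk_right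
  have hmem : MemLp (fun x => V x ω) p (volume : Measure (Cube d)) :=
    MemLp.of_bound hVω.aestronglyMeasurable r hVr
  refine ⟨hmem, ?_⟩
  simp only [lpPath_of_memLp hmem, lpPath_of_memLp (memLp_discretization p V _ ω)]
  rw [Lp.tendsto_Lp_iff_tendsto_eLpNorm'']
  exact tendsto_eLpNorm_sub_of_bounded (zero_lt_one.trans_le Fact.out).ne' hp
    (fun n => hVω.comp (measurable_gridPoint _)) hVω (fun n => hbound _) hVr hω

theorem isLpValued_of_ae_eq (hα : 0 < α) {p : ℝ≥0∞} [Fact (1 ≤ p)]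
    (hp : p ≠ ∞) (hM : IsSymmetricStableRandomMeasure α (volume : Measure (Cube d)) P M)
    (hVm : Measurable fun z : Cube d × Ω => V z.1 z.2) (hVM : ∀ x, V x =ᵐ[P] M (Set.Iic x)) :
    IsLpValued p P V := by
  obtain ⟨ms, hms⟩ :=
    exists_ae_tendsto_lpPath_discretization hα hp hM hVm hVM tendsto_two_pow_pnat
  exact ⟨hms.mono fun ω h => h.1, aemeasurable_of_tendsto_metrizable_ae atTop
    (fun n => (isLpValued_discretization (P := P) p hVm _).2) (hms.mono fun ω h => h.2)⟩

/-- The distributions of the discretizations on `L^p` converge weakly to that of the sheet. -/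
theorem tendsto_integral_lpLaw_discretization (hα : 0 < α) {p : ℝ≥0∞} [Fact (1 ≤ p)]
    (hp : p ≠ ∞) (hM : IsSymmetricStableRandomMeasure α (volume : Measure (Cube d)) P M)
    (hVm : Measurable fun z : Cube d × Ω => V z.1 z.2) (hVM : ∀ x, V x =ᵐ[P] M (Set.Iic x))
    {g : LpCube d p → ℝ} (hg : Continuous g) {C : ℝ} (hC : ∀ u, |g u| ≤ C) :
    Tendsto (fun N : ℕ+ => ∫ u, g u ∂(lpLaw p P (discretization V N))) atTop
      (𝓝 (∫ u, g u ∂(lpLaw p P V))) := by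
  have hD : ∀ N, AEMeasurable (lpPath p (discretization V N)) P := fun N =>
    (isLpValued_discretization p hVm N).2
  simp only [lpLaw, integral_map (hD _) hg.measurable.aestronglyMeasurable,
    integral_map (isLpValued_of_ae_eq hα hp hM hVm hVM).2 hg.measurable.aestronglyMeasurable]
  refine tendsto_of_subseq_tendsto fun ns hns => ?_
  obtain ⟨ms, hms⟩ := exists_ae_tendsto_lpPath_discretization hα hp hM hVm hVM hns
  refine ⟨ms, tendsto_integral_of_dominated_convergence (fun _ => C)
    (fun n => (hg.measurable.comp_aemeasurable (hD _)).aestronglyMeasurable)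
    (integrable_const C) (fun n => ae_of_all _ fun ω => hC _) ?_⟩
  filter_upwards [hms] with ω hω
  exact (hg.tendsto _).comp hω.2

end

/-! ### Posterior distributions -/

section

variable {F G : Type*} [MeasurableSpace F] {Φ : F × G → ℝ} {y : G}

theorem integral_posteriorMeasure (μ : Measure F) (f : F → ℝ) :
    ∫ u, f u ∂(posteriorMeasure Φ μ y) =
      (∫ u, Real.exp (-Φ (u, y)) * f u ∂μ) / ∫ u, Real.exp (-Φ (u, y)) ∂μ := by
  rw [posteriorMeasure, integral_tilted, ← integral_div]
  refine integral_congr_ae (ae_of_all _ fun u => ?_)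
  simp only [smul_eq_mul]
  ring

variable [TopologicalSpace F] [BorelSpace F]

theorem integrable_exp_neg_of_nonneg (hΦ0 : ∀ z, 0 ≤ Φ z)
    (hc : Continuous fun u => Φ (u, y)) (μ : Measure F) [IsFiniteMeasure μ] :
    Integrable (fun u => Real.exp (-Φ (u, y))) μ :=
  Integrable.of_bound (C := 1) hc.neg.rexp.measurable.aestronglyMeasurable (ae_of_all _ fun u => by
    rw [Real.norm_eq_abs, Real.abs_exp]
    exact Real.exp_le_one_iff.2 (neg_nonpos.2 (hΦ0 _)))

theorem normalizer_eq_ofReal (hΦ0 : ∀ z, 0 ≤ Φ z)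
    (hc : Continuous fun u => Φ (u, y)) (μ : Measure F) [IsFiniteMeasure μ] :
    normalizer (y := y) Φ μ = ENNReal.ofReal (∫ u, Real.exp (-Φ (u, y)) ∂μ) :=
  (ofReal_integral_eq_lintegral_ofReal (integrable_exp_neg_of_nonneg hΦ0 hc μ)
    (ae_of_all _ fun _ => (Real.exp_pos _).le)).symm

theorem normalizer_pos_and_lt_top (hΦ0 : ∀ z, 0 ≤ Φ z)
    (hc : Continuous fun u => Φ (u, y)) (μ : Measure F) [IsProbabilityMeasure μ] :
    0 < normalizer Φ μ y ∧ normalizer Φ μ y < ∞ := by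
  rw [normalizer_eq_ofReal hΦ0 hc]
  exact ⟨ENNReal.ofReal_pos.2 (integral_exp_pos (integrable_exp_neg_of_nonneg hΦ0 hc μ)),
    ENNReal.ofReal_lt_top⟩

theorem isProbabilityMeasure_posteriorMeasure (hΦ0 : ∀ z, 0 ≤ Φ z)
    (hc : Continuous fun u => Φ (u, y)) (μ : Measure F) [IsProbabilityMeasure μ] :
    IsProbabilityMeasure (posteriorMeasure Φ μ y) :=
  isProbabilityMeasure_tilted (integrable_exp_neg_of_nonneg hΦ0 hc μ)

end

theorem mainTheorem1 (d : ℕ) (α : ℝ) (hα0 : 0 < α) (hα2 : α < 2)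
    (p : ℝ≥0∞) [Fact (1 ≤ p)] (hp : p ≠ ∞)
    {Ω : Type*} [MeasurableSpace Ω] (P : Measure Ω) [IsProbabilityMeasure P]
    (U : Cube d → Ω → ℝ) (hU : IsStableSheet d α P U)
    {G : Type*} [NormedAddCommGroup G] [NormedSpace ℝ G]
    (Φ : LpCube d p × G → ℝ) (hΦ0 : ∀ z, 0 ≤ Φ z) (hWD2 : BoundedOnBounded Φ)
    (hPC1 : ∀ y : G, Continuous (fun u : LpCube d p => Φ (u, y))) :
    (∃ V : Cube d → Ω → ℝ, IsMeasurableVersion P U V) ∧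
    ∀ V : Cube d → Ω → ℝ, IsMeasurableVersion P U V →
      IsLpValued p P V ∧ (∀ N : ℕ+, IsLpValued p P (discretization V N)) ∧
      ∀ y : G,
        (0 < normalizer Φ (lpLaw p P V) y ∧ normalizer Φ (lpLaw p P V) y < ∞) ∧
        (∀ N : ℕ+, 0 < normalizer Φ (lpLaw p P (discretization V N)) y ∧
          normalizer Φ (lpLaw p P (discretization V N)) y < ∞) ∧
        ∃ (h : IsProbabilityMeasure (posteriorMeasure Φ (lpLaw p P V) y))
          (hN : ∀ N : ℕ+,
            IsProbabilityMeasure (posteriorMeasure Φ (lpLaw p P (discretization V N)) y)),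
          Tendsto (β := ProbabilityMeasure (LpCube d p))
            (fun N : ℕ+ => ⟨posteriorMeasure Φ (lpLaw p P (discretization V N)) y, hN N⟩)
            atTop (𝓝 ⟨posteriorMeasure Φ (lpLaw p P V) y, h⟩) := by
  refine ⟨hU.exists_isMeasurableVersion hα0, fun V ⟨hVm, hVU⟩ => ?_⟩
  obtain ⟨M, hM, hUM⟩ := hU
  have hVM : ∀ x, V x =ᵐ[P] M (Set.Iic x) := fun x => (hVU x).trans (hUM x)
  have hL : IsLpValued p P V := isLpValued_of_ae_eq hα0 hp hM hVm hVM
  have hLN : ∀ N, IsLpValued p P (discretization V N) := isLpValued_discretization p hVm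
  have hprob : IsProbabilityMeasure (lpLaw p P V) := Measure.isProbabilityMeasure_map hL.2
  have hprobN : ∀ N, IsProbabilityMeasure (lpLaw p P (discretization V N)) := fun N =>
    Measure.isProbabilityMeasure_map (hLN N).2
  refine ⟨hL, hLN, fun y => ?_⟩
  have hint := fun (μ : Measure (LpCube d p)) [IsFiniteMeasure μ] =>
    integrable_exp_neg_of_nonneg hΦ0 (hPC1 y) μ
  have hle : ∀ u, Real.exp (-Φ (u, y)) ≤ 1 := fun u =>
    Real.exp_le_one_iff.2 (neg_nonpos.2 (hΦ0 _))
  refine ⟨normalizer_pos_and_lt_top hΦ0 (hPC1 y) _,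
    fun N => normalizer_pos_and_lt_top hΦ0 (hPC1 y) _,
    isProbabilityMeasure_posteriorMeasure hΦ0 (hPC1 y) _,
    fun N => isProbabilityMeasure_posteriorMeasure hΦ0 (hPC1 y) _,
    ProbabilityMeasure.tendsto_iff_forall_integral_tendsto.2 fun f => ?_⟩
  simp only [ProbabilityMeasure.coe_mk, integral_posteriorMeasure]
  refine Tendsto.div ?_ ?_ (integral_exp_pos (hint _)).ne'
  · refine tendsto_integral_lpLaw_discretization hα0 hp hM hVm hVM
      ((hPC1 y).neg.rexp.mul f.continuous) (C := ‖f‖) fun u => ?_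
    rw [abs_mul, Real.abs_exp]
    exact (mul_le_of_le_one_left (abs_nonneg _) (hle u)).trans (f.norm_coe_le_norm u)
  · exact tendsto_integral_lpLaw_discretization hα0 hp hM hVm hVM (hPC1 y).neg.rexp (C := 1)
      fun u => by rw [Real.abs_exp]; exact hle u
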